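/- Let $x_1,\dots,x_4$ and $y_1,\dots,y_4$ be labeled points of the complex projective plane $\mathbb{P}^2$ in general position, i.e. no three of the $x_i$ are collinear and no three of the $y_i$ are collinear. Let $E_4\subset\mathbb{P}^2\times\mathbb{P}^2$ be their camera centers variety, i.e. the set of all $(a,b)$ for which there is a nonzero complex $3\times 3$ matrix $F$ with $Fa=0$, $F^{\top}b=0$ and $y_i^{\top}Fx_i=0$ for $i=1,\dots,4$. Let $\pi_x,\pi_y$ be the projections of $E_4$ to the first and the second factor. Then $E_4$ is a hypersurface in $\mathbb{P}^2\times\mathbb{P}^2$ (it is the zero locus of a nonconstant bihomogeneous polynomial that generates its vanishing ideal). Furthermore: 1. If both point sets are in standard position, i.e. $x_i\sim y_i\sim e_i$ for $i=1,\dots,4$, where $e_1,e_2,e_3$ are the standard basis vectors and $e_4=e_1+e_2+e_3$, then the equation of $E_4$ is $a^{\top}[a\odot b]_{\times}b=0$ (this polynomial cuts out $E_4$ and generates its vanishing ideal). Here $\odot$ is the entrywise product and $[v]_\times$ is the matrix of $w\mapsto v\times w$. 2. $\pi_x(E_4)=\pi_y(E_4)=\mathbb{P}^2$. 3. $E_4$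 has bidegree $(2,2)$: its vanishing ideal is generated by a bihomogeneous polynomial of bidegree $(2,2)$, and its multidegrees are $d_{(2,1)}(E_4)=d_{(1,2)}(E_4)=2$, where $d_{(i,j)}$ is the number of points of $E_4$ that lie on $i$ generic lines of the first plane and $j$ generic lines of the second. 4. For every $a\in\mathbb{P}^2\setminus\{x_1,\dots,x_4\}$ the fiber $\pi_x^{-1}(a)$ projects onto a conic in the second plane (the zero locus of a quadratic form of rank at least $2$), which is nondegenerate if $a$ lies on no line through two of the $x_i$. Likewise, for every $b\in\mathbb{P}^2\setminus\{y_1,\dots,y_4\}$ the fiber $\pi_y^{-1}(b)$ projects onto a conic in the first plane, which is nondegenerate if $b$ lies on no line through two of the $y_i$. -/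

import Mathlib

namespace CameraCenters

open Matrix MvPolynomial
open scoped LinearAlgebra.Projectivization

/-- The complex projective plane. -/
abbrev P2 : Type := ℙ ℂ (Fin 3 → ℂ)

/-- The projective space of nonzero complex `3 × 3` matrices up to scale. -/
abbrev P8 : Type := ℙ ℂ (Matrix (Fin 3) (Fin 3) ℂ)

/-! All conditions below that are written with the representatives `p.rep` of projective points
are homogeneous in each of them, hence do not depend on the choice of the representatives. -/

/-- The variety of all `(F, a, b)` with `F a = 0`, `Fᵀ b = 0` and `yᵢᵀ F xᵢ = 0` for all `i`. -/
def fundamentalEpipoles {n : ℕ} (x y : Fin n → P2) : Set (P8 × P2 × P2) :=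
  {t | t.1.rep *ᵥ t.2.1.rep = 0 ∧ t.1.repᵀ *ᵥ t.2.2.rep = 0 ∧
    ∀ i, (y i).rep ⬝ᵥ (t.1.rep *ᵥ (x i).rep) = 0}

/-- The camera centers variety of two labeled point sets: the image of `fundamentalEpipoles x y`
under the projection that forgets `F`. -/
def cameraCenters {n : ℕ} (x y : Fin n → P2) : Set (P2 × P2) :=
  Prod.snd '' fundamentalEpipoles x y

/-- No three of the labeled points lie on a line (in particular any two are distinct
when there are at least three of them). -/
def GeneralPosition {n : ℕ} (x : Fin n → P2) : Prop :=
  ∀ s : Fin 3 ↪ Fin n, Projectivization.Independent (x ∘ s)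

/-- The vectors `e₁, e₂, e₃, e₄ = e₁ + e₂ + e₃`. -/
def frameVec : Fin 4 → Fin 3 → ℂ :=
  ![![1, 0, 0], ![0, 1, 0], ![0, 0, 1], ![1, 1, 1]]

theorem frameVec_ne_zero (i : Fin 4) : frameVec i ≠ 0 := by
  intro h
  have h0 := congrFun h 0
  have h1 := congrFun h 1
  have h2 := congrFun h 2
  fin_cases i <;> simp [frameVec] at h0 h1 h2

/-- Four labeled points are in standard position if the `i`-th one is represented by `eᵢ`. -/
def StandardPosition (x : Fin 4 → P2) : Prop :=
  ∀ i, x i = Projectivization.mk ℂ (frameVec i) (frameVec_ne_zero i)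

/-- The matrix `[v]_×` of the linear map `w ↦ v × w`. -/
def crossMatrix {R : Type*} [CommRing R] (v : Fin 3 → R) : Matrix (Fin 3) (Fin 3) R :=
  !![0, -v 2, v 1;
     v 2, 0, -v 0;
     -v 1, v 0, 0]

/-- The coordinate ring of `P2 × P2`: the variables `inl i` are the coordinates of the first
factor, the variables `inr i` those of the second. -/
abbrev BiPoly : Type := MvPolynomial (Fin 3 ⊕ Fin 3) ℂ

/-- The polynomial `aᵀ [a ⊙ b]_× b`; the product `a * b` of vectors is the entrywise one. -/
noncomputable def standardEquation : BiPoly :=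
  let a : Fin 3 → BiPoly := fun i => X (Sum.inl i)
  let b : Fin 3 → BiPoly := fun i => X (Sum.inr i)
  a ⬝ᵥ (crossMatrix (a * b) *ᵥ b)

/-- `f` is bihomogeneous of degree `d` in the first and degree `e` in the second three variables. -/
def IsBihomogeneous (f : BiPoly) (d e : ℕ) : Prop :=
  IsWeightedHomogeneous (Sum.elim (fun _ => ((1, 0) : ℕ × ℕ)) (fun _ => ((0, 1) : ℕ × ℕ))) f (d, e)

/-- The zero locus in `P2 × P2` of a bihomogeneous polynomial. -/
def biZeroLocus (f : BiPoly) : Set (P2 × P2) :=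
  {p | eval (Sum.elim p.1.rep p.2.rep) f = 0}

/-- All pairs of nonzero vectors that represent a point of `E`. -/
def biCone (E : Set (P2 × P2)) : Set (Fin 3 ⊕ Fin 3 → ℂ) :=
  {w | ∃ (u v : Fin 3 → ℂ) (hu : u ≠ 0) (hv : v ≠ 0),
    (Projectivization.mk ℂ u hu, Projectivization.mk ℂ v hv) ∈ E ∧ w = Sum.elim u v}

/-- `f` is the equation of `E` (as a reduced variety): `E` is the zero locus of `f`, and `f`
generates the ideal of all polynomials that vanish on `E`. -/
def IsEquationOf (f : BiPoly) (E : Set (P2 × P2)) : Prop :=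
  E = biZeroLocus f ∧ vanishingIdeal ℂ (biCone E) = Ideal.span {f}

/-- `E` is a hypersurface of bidegree `(d, e)`. -/
def IsHypersurfaceOfBidegree (E : Set (P2 × P2)) (d e : ℕ) : Prop :=
  ∃ f : BiPoly, f ≠ 0 ∧ IsBihomogeneous f d e ∧ IsEquationOf f E

/-- `E` is a hypersurface: it is given by one nonzero bihomogeneous polynomial that is
not constant. -/
def IsHypersurface (E : Set (P2 × P2)) : Prop :=
  ∃ d e : ℕ, (d, e) ≠ (0, 0) ∧ IsHypersurfaceOfBidegree E d e

/-- The points of `E` on the lines `u k` of the first plane and the lines `v l` of the second;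
a line is given by the coefficients of a linear form. -/
def slice (E : Set (P2 × P2)) {i j : ℕ} (u : Fin i → Fin 3 → ℂ) (v : Fin j → Fin 3 → ℂ) :
    Set (P2 × P2) :=
  {p | p ∈ E ∧ (∀ k, u k ⬝ᵥ p.1.rep = 0) ∧ ∀ l, v l ⬝ᵥ p.2.rep = 0}

/-- The multidegree `d_(i,j)` of `E` is `m`: the number of points of `E` on `i` generic lines of
the first plane and `j` generic lines of the second is `m`. Generic means that the coefficients
of the lines lie in a nonempty Zariski open set, which may be taken to be the complement of the
zero locus of a nonzero polynomial `G`. -/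
def HasMultidegree (E : Set (P2 × P2)) (i j m : ℕ) : Prop :=
  ∃ G : MvPolynomial ((Fin i × Fin 3) ⊕ (Fin j × Fin 3)) ℂ, G ≠ 0 ∧
    ∀ (u : Fin i → Fin 3 → ℂ) (v : Fin j → Fin 3 → ℂ),
      eval (Sum.elim (fun t => u t.1 t.2) (fun t => v t.1 t.2)) G ≠ 0 →
        (slice E u v).encard = m

/-- The zero locus in the plane of the quadratic form of a matrix. -/
def quadric (M : Matrix (Fin 3) (Fin 3) ℂ) : Set P2 :=
  {p | p.rep ⬝ᵥ (M *ᵥ p.rep) = 0}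

/-- A (reduced) plane conic: the zero locus of a quadratic form of rank at least two, that is,
a nondegenerate conic or a union of two distinct lines. -/
def IsConic (C : Set P2) : Prop :=
  ∃ M : Matrix (Fin 3) (Fin 3) ℂ, M.IsSymm ∧ 2 ≤ M.rank ∧ C = quadric M

/-- A nondegenerate plane conic. -/
def IsNondegenerateConic (C : Set P2) : Prop :=
  ∃ M : Matrix (Fin 3) (Fin 3) ℂ, M.IsSymm ∧ M.det ≠ 0 ∧ C = quadric M

/-- The point `p` lies on no line through two of the labeled points. -/
def OffLines {n : ℕ} (x : Fin n → P2) (p : P2) : Prop :=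
  ∀ i j, i ≠ j → Projectivization.Independent ![x i, x j, p]

/-- The projection to the second plane of the fiber of `E` over `a` in the first. -/
def fiberOverFst (E : Set (P2 × P2)) (a : P2) : Set P2 :=
  Prod.snd '' (E ∩ Prod.fst ⁻¹' {a})

/-- The projection to the first plane of the fiber of `E` over `b` in the second. -/
def fiberOverSnd (E : Set (P2 × P2)) (b : P2) : Set P2 :=
  Prod.fst '' (E ∩ Prod.snd ⁻¹' {b})

end CameraCenters

/-!
Projective transformations `g` and `h` of the two planes carry `E₄` to the camera centers variety
of the transformed points, so both point sets may be taken in standard position. There the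
epipolar conditions at `e₁, e₂, e₃` say that `F` has zero diagonal, and for `b₀ ≠ 0` the rest is a
square linear system for `F` whose determinant is `b₀` times the value of `aᵀ [a ⊙ b]_× b`. This
polynomial is linear in `a₀` with coprime coefficients, hence irreducible, and generates the
vanishing ideal by the Nullstellensatz.

The fiber over `a` is the conic of an explicit symmetric matrix with zero diagonal: such a matrix
has rank at least two unless it is zero, which happens only at `e₁, …, e₄`. Two generic lines of
the first plane single out one `a`, and a line `v` meets a conic with symmetric matrix `S` in two
points as soon as `vᵀ adj(S) v ≠ 0`.
-/

namespace CameraCenters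

open Matrix MvPolynomial
open scoped LinearAlgebra.Projectivization MatrixGroups Kronecker

section ProjectiveFrame

variable {K : Type*} [Field K]

theorem exists_det_ne_zero_mulVec_eq_smul {n : ℕ} {u : Fin (n + 1) → Fin n → K}
    (hu : ∀ s : Fin n ↪ Fin (n + 1), LinearIndependent K (u ∘ s)) :
    ∃ B : Matrix (Fin n) (Fin n) K, B.det ≠ 0 ∧
      (∀ i, ∃ c : K, B *ᵥ Pi.single i 1 = c • u i.castSucc) ∧
      ∃ c : K, B *ᵥ 1 = c • u (Fin.last n) := by
  have det_ne_zero (s : Fin n ↪ Fin (n + 1)) : (of (u ∘ s))ᵀ.det ≠ 0 := by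
    rw [← isUnit_iff_ne_zero, ← isUnit_iff_isUnit_det]
    exact linearIndependent_cols_iff_isUnit.1 (hu s)
  set A : Matrix (Fin n) (Fin n) K := (of (u ∘ Fin.castSuccEmb))ᵀ
  have cramer_ne_zero (i : Fin n) : A.cramer (u (Fin.last n)) i ≠ 0 := by
    have hinj : Function.Injective
        (Function.update (Fin.castSucc : Fin n → Fin (n + 1)) i (Fin.last n)) := by
      intro j k hjk
      by_cases hj : j = i <;> by_cases hk : k = i <;>
        simp_all [Fin.castSucc_ne_last, (Fin.castSucc_ne_last _).symm]
    rw [cramer_apply]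
    convert det_ne_zero ⟨_, hinj⟩ using 2
    ext j k
    by_cases hk : k = i <;> simp [A, hk]
  refine ⟨A * diagonal (A.cramer (u (Fin.last n))), ?_,
    fun i => ⟨A.cramer (u (Fin.last n)) i, ?_⟩, A.det, ?_⟩
  · rw [det_mul, det_diagonal]
    exact mul_ne_zero (det_ne_zero _) (Finset.prod_ne_zero_iff.2 fun i _ => cramer_ne_zero i)
  · ext j
    simp [A, mul_comm]
  · rw [← mulVec_cramer, ← mulVec_mulVec]
    congr 1
    ext i
    simp [mulVec_diagonal]

theorem exists_specialLinearGroup_eq_smul [IsAlgClosed K] {n : ℕ} [NeZero n]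
    {B : Matrix (Fin n) (Fin n) K} (hB : B.det ≠ 0) :
    ∃ (g : SL(n, K)) (c : K), g.1 = c • B := by
  obtain ⟨c, hc⟩ := IsAlgClosed.exists_pow_nat_eq B.det⁻¹ (NeZero.pos n)
  exact ⟨⟨c • B, by rw [det_smul, Fintype.card_fin, hc, inv_mul_cancel₀ hB]⟩, c, rfl⟩

end ProjectiveFrame

theorem frameVec_castSucc (i : Fin 3) : frameVec i.castSucc = Pi.single i 1 := by
  fin_cases i <;> ext j <;> fin_cases j <;> rfl

theorem frameVec_last : frameVec (Fin.last 3) = 1 := by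
  ext j; fin_cases j <;> rfl

theorem GeneralPosition.exists_smul_standardPosition {x : Fin 4 → P2} (hx : GeneralPosition x) :
    ∃ g : SL(3, ℂ), StandardPosition (g • x) := by
  obtain ⟨B, hB, hsingle, hone⟩ := exists_det_ne_zero_mulVec_eq_smul (K := ℂ)
    (u := fun i => (x i).rep) fun s => Projectivization.independent_iff.1 (hx s)
  have exists_eq_smul (i : Fin 4) : ∃ c : ℂ, B *ᵥ frameVec i = c • (x i).rep := by
    refine Fin.lastCases ?_ (fun j => ?_) i
    · rw [frameVec_last]
      exact hone
    · rw [frameVec_castSucc]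
      exact hsingle j
  obtain ⟨g, k, hg⟩ := exists_specialLinearGroup_eq_smul hB
  refine ⟨g⁻¹, fun i => ?_⟩
  obtain ⟨c, hc⟩ := exists_eq_smul i
  rw [Pi.smul_apply, inv_smul_eq_iff, Projectivization.smul_mk, ← (x i).mk_rep, eq_comm,
    Projectivization.mk_eq_mk_iff']
  exact ⟨k * c, by
    rw [Matrix.SpecialLinearGroup.smul_def, smul_eq_mulVec, hg, smul_mulVec, hc, smul_smul]⟩

section Projectivization

variable {ι K V : Type*} [Field K] [AddCommGroup V] [Module K V]

theorem exists_eq_mk (x : ι → ℙ K V) :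
    ∃ (u : ι → V) (hu : ∀ i, u i ≠ 0), x = fun i => .mk K (u i) (hu i) :=
  ⟨fun i => (x i).rep, fun i => (x i).rep_nonzero, funext fun i => (x i).mk_rep.symm⟩

end Projectivization

theorem specialLinearGroup_smul_eq {R : Type*} [CommRing R] {n : ℕ} (g : SL(n, R))
    (v : Fin n → R) : g • v = g.1 *ᵥ v :=
  rfl

theorem isUnit_coe {R : Type*} [CommRing R] {n : ℕ} (g : SL(n, R)) : IsUnit g.1 := by
  simp [isUnit_iff_isUnit_det]

section Equivariance

variable {n : ℕ}

theorem mk_mem_cameraCenters_iff {u v : Fin n → Fin 3 → ℂ} (hu : ∀ i, u i ≠ 0)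
    (hv : ∀ i, v i ≠ 0) {a b : Fin 3 → ℂ} (ha : a ≠ 0) (hb : b ≠ 0) :
    (.mk ℂ a ha, .mk ℂ b hb) ∈
        cameraCenters (fun i => .mk ℂ (u i) (hu i)) (fun i => .mk ℂ (v i) (hv i)) ↔
      ∃ F : Matrix (Fin 3) (Fin 3) ℂ, F ≠ 0 ∧ F *ᵥ a = 0 ∧ Fᵀ *ᵥ b = 0 ∧
        ∀ i, v i ⬝ᵥ (F *ᵥ u i) = 0 := by
  have rep_iff (F : Matrix (Fin 3) (Fin 3) ℂ) :
      (F *ᵥ (Projectivization.mk ℂ a ha).rep = 0 ∧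
        Fᵀ *ᵥ (Projectivization.mk ℂ b hb).rep = 0 ∧
        ∀ i, (Projectivization.mk ℂ (v i) (hv i)).rep ⬝ᵥ
          (F *ᵥ (Projectivization.mk ℂ (u i) (hu i)).rep) = 0) ↔
      F *ᵥ a = 0 ∧ Fᵀ *ᵥ b = 0 ∧ ∀ i, v i ⬝ᵥ (F *ᵥ u i) = 0 := by
    obtain ⟨s, hs⟩ := Projectivization.exists_smul_eq_mk_rep ℂ a ha
    obtain ⟨t, ht⟩ := Projectivization.exists_smul_eq_mk_rep ℂ b hb
    choose c hc using fun i => Projectivization.exists_smul_eq_mk_rep ℂ (u i) (hu i)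
    choose d hd using fun i => Projectivization.exists_smul_eq_mk_rep ℂ (v i) (hv i)
    simp only [← hs, ← ht, ← hc, ← hd, mulVec_smul, dotProduct_smul, smul_dotProduct,
      smul_eq_zero_iff_eq]
  constructor
  · rintro ⟨⟨F, _, _⟩, hF, ⟨rfl, rfl⟩⟩
    exact ⟨F.rep, F.rep_nonzero, (rep_iff F.rep).1 hF⟩
  · rintro ⟨F, hF, h⟩
    obtain ⟨r, hr⟩ := Projectivization.exists_smul_eq_mk_rep ℂ F hF
    refine ⟨(.mk ℂ F hF, _, _), (rep_iff _).2 ?_, rfl⟩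
    simpa only [← hr, smul_mulVec, transpose_smul, dotProduct_smul, smul_eq_zero_iff_eq] using h

theorem cameraCenters_swap (x y : Fin n → P2) :
    cameraCenters y x = Prod.swap ⁻¹' cameraCenters x y := by
  obtain ⟨u, hu, rfl⟩ := exists_eq_mk x
  obtain ⟨v, hv, rfl⟩ := exists_eq_mk y
  ext ⟨a, b⟩
  induction a using Projectivization.ind with | h a ha =>
  induction b using Projectivization.ind with | h b hb =>
  rw [Set.mem_preimage, Prod.swap_prod_mk, mk_mem_cameraCenters_iff, mk_mem_cameraCenters_iff]
  have dotProduct_transpose (F : Matrix (Fin 3) (Fin 3) ℂ) (p q : Fin 3 → ℂ) :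
      p ⬝ᵥ (Fᵀ *ᵥ q) = q ⬝ᵥ (F *ᵥ p) := by
    rw [dotProduct_mulVec, vecMul_transpose, dotProduct_comm]
  constructor <;> rintro ⟨F, hF, hFa, hFb, hFi⟩ <;>
    exact ⟨Fᵀ, mt transpose_eq_zero.1 hF, hFb, hFa,
      fun i => (dotProduct_transpose _ _ _).trans (hFi i)⟩

theorem smul_mem_cameraCenters_smul {x y : Fin n → P2} (g h : SL(3, ℂ)) {p : P2 × P2}
    (hp : p ∈ cameraCenters x y) : (g • p.1, h • p.2) ∈ cameraCenters (g • x) (h • y) := by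
  obtain ⟨u, hu, rfl⟩ := exists_eq_mk x
  obtain ⟨v, hv, rfl⟩ := exists_eq_mk y
  obtain ⟨a, b⟩ := p
  induction a using Projectivization.ind with | h a ha =>
  induction b using Projectivization.ind with | h b hb =>
  obtain ⟨F, hF, hFa, hFb, hFi⟩ := (mk_mem_cameraCenters_iff hu hv ha hb).1 hp
  have transform_mulVec (q : Fin 3 → ℂ) :
      (h⁻¹.1ᵀ * F * g⁻¹.1) *ᵥ (g • q) = h⁻¹.1ᵀ *ᵥ (F *ᵥ q) := by
    rw [← mulVec_mulVec, ← mulVec_mulVec, ← specialLinearGroup_smul_eq, inv_smul_smul]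
  have transform_transpose_mulVec (q : Fin 3 → ℂ) :
      (h⁻¹.1ᵀ * F * g⁻¹.1)ᵀ *ᵥ (h • q) = g⁻¹.1ᵀ *ᵥ (Fᵀ *ᵥ q) := by
    rw [transpose_mul, transpose_mul, transpose_transpose, ← mulVec_mulVec, ← mulVec_mulVec,
      ← specialLinearGroup_smul_eq h⁻¹, inv_smul_smul]
  refine (mk_mem_cameraCenters_iff (u := g • u) (v := h • v) (a := g • a) (b := h • b) _ _ _ _).2
    ⟨h⁻¹.1ᵀ * F * g⁻¹.1, fun h0 => hF ?_, ?_, ?_, fun i => ?_⟩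
  · rwa [(isUnit_coe g⁻¹).mul_left_eq_zero,
      ((isUnit_transpose _).2 (isUnit_coe h⁻¹)).mul_right_eq_zero] at h0
  · rw [transform_mulVec, hFa, mulVec_zero]
  · rw [transform_transpose_mulVec, hFb, mulVec_zero]
  · rw [Pi.smul_apply, Pi.smul_apply, transform_mulVec, dotProduct_mulVec, vecMul_transpose,
      ← specialLinearGroup_smul_eq, inv_smul_smul, hFi]

theorem preimage_cameraCenters_smul (x y : Fin n → P2) (g h : SL(3, ℂ)) :
    Prod.map (g • ·) (h • ·) ⁻¹' cameraCenters (g • x) (h • y) = cameraCenters x y := by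
  ext p
  refine ⟨fun hp => ?_, smul_mem_cameraCenters_smul g h⟩
  simpa only [Prod.map, inv_smul_smul] using smul_mem_cameraCenters_smul g⁻¹ h⁻¹ hp

end Equivariance

section TripleForm

variable {R : Type*} [CommRing R]

/-- The value of `aᵀ [a ⊙ b]_× b`, the form of which `standardEquation` is the generic value. -/
def tripleForm (a b : Fin 3 → R) : R :=
  a ⬝ᵥ (crossMatrix (a * b) *ᵥ b)

theorem tripleForm_eq (a b : Fin 3 → R) :
    tripleForm a b = a 0 * a 1 * (b 2 * (b 1 - b 0)) + a 0 * a 2 * (b 1 * (b 0 - b 2)) +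
      a 1 * a 2 * (b 0 * (b 2 - b 1)) := by
  simp [tripleForm, crossMatrix, dotProduct, mulVec, Fin.sum_univ_three]
  ring

theorem tripleForm_self (a : Fin 3 → R) : tripleForm a a = 0 := by
  rw [tripleForm_eq]; ring

theorem tripleForm_comp_addLeft (k : Fin 3) (a b : Fin 3 → R) :
    tripleForm (a ∘ Equiv.addLeft k) (b ∘ Equiv.addLeft k) = tripleForm a b := by
  simp only [tripleForm_eq, Function.comp_apply, Equiv.coe_addLeft]
  fin_cases k <;> simp only [Fin.reduceFinMk, Fin.reduceAdd, Fin.zero_eta, Fin.mk_one, zero_add,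
    add_zero] <;> ring

end TripleForm

section FrameEpipolar

variable {R : Type*} [CommRing R] {n : ℕ}

/-- `F` has kernel vectors `a` on the right and `b` on the left and satisfies the epipolar
constraints `xᵢᵀ F xᵢ = 0` of the projective frame `e₁, …, eₙ, e₁ + ⋯ + eₙ`. -/
structure IsFrameEpipolar (F : Matrix (Fin n) (Fin n) R) (a b : Fin n → R) : Prop where
  mulVec_eq_zero : F *ᵥ a = 0
  transpose_mulVec_eq_zero : Fᵀ *ᵥ b = 0
  diag_eq_zero : F.diag = 0
  one_dotProduct_mulVec_one : 1 ⬝ᵥ (F *ᵥ 1) = 0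

theorem IsFrameEpipolar.submatrix {F : Matrix (Fin n) (Fin n) R} {a b : Fin n → R}
    (h : IsFrameEpipolar F a b) (σ : Equiv.Perm (Fin n)) :
    IsFrameEpipolar (F.submatrix σ σ) (a ∘ σ) (b ∘ σ) where
  mulVec_eq_zero := by
    rw [submatrix_mulVec_equiv, Function.comp_assoc, Equiv.self_comp_symm, Function.comp_id,
      h.mulVec_eq_zero, Pi.zero_comp]
  transpose_mulVec_eq_zero := by
    rw [transpose_submatrix, submatrix_mulVec_equiv, Function.comp_assoc, Equiv.self_comp_symm,
      Function.comp_id, h.transpose_mulVec_eq_zero, Pi.zero_comp]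
  diag_eq_zero := by
    rw [diag_submatrix, h.diag_eq_zero, Pi.zero_comp]
  one_dotProduct_mulVec_one := by
    rw [submatrix_mulVec_equiv, Pi.one_comp]
    exact (comp_equiv_dotProduct_comp_equiv 1 (F *ᵥ 1) σ).trans h.one_dotProduct_mulVec_one

theorem exists_isFrameEpipolar_comp_iff (σ : Equiv.Perm (Fin n)) (a b : Fin n → R) :
    (∃ F, F ≠ 0 ∧ IsFrameEpipolar F (a ∘ σ) (b ∘ σ)) ↔ ∃ F, F ≠ 0 ∧ IsFrameEpipolar F a b := by
  have submatrix_ne_zero {F : Matrix (Fin n) (Fin n) R} (hF : F ≠ 0) (τ : Equiv.Perm (Fin n)) :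
      F.submatrix τ τ ≠ 0 := fun h0 => hF (by simpa using congrArg (·.submatrix τ.symm τ.symm) h0)
  constructor
  · rintro ⟨F, hF, h⟩
    refine ⟨F.submatrix σ.symm σ.symm, submatrix_ne_zero hF _, ?_⟩
    simpa [Function.comp_assoc] using h.submatrix σ.symm
  · rintro ⟨F, hF, h⟩
    exact ⟨F.submatrix σ σ, submatrix_ne_zero hF σ, h.submatrix σ⟩

/-- The matrices with zero diagonal whose last two columns are orthogonal to `b`, parametrized
by `w`. -/
def hollowMatrix (b : Fin 3 → R) (w : Fin 4 → R) : Matrix (Fin 3) (Fin 3) R :=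
  !![0, -(b 2 * w 3), -(b 1 * w 2);
     w 0, 0, b 0 * w 2;
     w 1, b 0 * w 3, 0]

/-- The matrix of the linear system in `w` that makes `hollowMatrix b w` a frame epipolar matrix
for `a` and `b`. -/
def frameSystem (a b : Fin 3 → R) : Matrix (Fin 4) (Fin 4) R :=
  !![1, 1, b 0 - b 1, b 0 - b 2;
     b 1, b 2, 0, 0;
     a 0, 0, b 0 * a 2, 0;
     0, a 0, 0, b 0 * a 1]

theorem det_frameSystem (a b : Fin 3 → R) : (frameSystem a b).det = b 0 * tripleForm a b := by
  rw [tripleForm_eq]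
  simp [frameSystem, det_succ_row_zero, Fin.sum_univ_succ, Fin.succAbove]
  ring

variable [IsDomain R]

theorem isFrameEpipolar_hollowMatrix_iff {a b : Fin 3 → R} (hb : b 0 ≠ 0) {w : Fin 4 → R} :
    IsFrameEpipolar (hollowMatrix b w) a b ↔ frameSystem a b *ᵥ w = 0 := by
  have hsum : 1 ⬝ᵥ (hollowMatrix b w *ᵥ 1) = (frameSystem a b *ᵥ w) 0 := by
    simp [hollowMatrix, frameSystem, dotProduct, mulVec, Fin.sum_univ_succ]
    ring
  have hcol : (hollowMatrix b w)ᵀ *ᵥ b = ![(frameSystem a b *ᵥ w) 1, 0, 0] := by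
    ext i
    fin_cases i <;>
      simp [hollowMatrix, frameSystem, dotProduct, mulVec, Fin.sum_univ_succ] <;> ring
  have hrow : hollowMatrix b w *ᵥ a = ![-(b 2 * w 3 * a 1 + b 1 * w 2 * a 2),
      (frameSystem a b *ᵥ w) 2, (frameSystem a b *ᵥ w) 3] := by
    ext i
    fin_cases i <;>
      simp [hollowMatrix, frameSystem, dotProduct, mulVec, Fin.sum_univ_succ] <;> ring
  constructor
  · intro h
    ext i
    fin_cases i
    · exact hsum.symm.trans h.one_dotProduct_mulVec_one
    · simpa [hcol] using congrFun h.transpose_mulVec_eq_zero 0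
    · simpa [hrow] using congrFun h.mulVec_eq_zero 1
    · simpa [hrow] using congrFun h.mulVec_eq_zero 2
  · intro h
    have hrow_zero : b 2 * w 3 * a 1 + b 1 * w 2 * a 2 = 0 := by
      have h1 : b 1 * w 0 + b 2 * w 1 = 0 := by
        simpa [frameSystem, mulVec, dotProduct, Fin.sum_univ_succ] using congrFun h 1
      have h2 : a 0 * w 0 + b 0 * a 2 * w 2 = 0 := by
        simpa [frameSystem, mulVec, dotProduct, Fin.sum_univ_succ] using congrFun h 2
      have h3 : a 0 * w 1 + b 0 * a 1 * w 3 = 0 := by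
        simpa [frameSystem, mulVec, dotProduct, Fin.sum_univ_succ] using congrFun h 3
      refine (mul_eq_zero.1 ?_).resolve_left hb
      linear_combination b 1 * h2 + b 2 * h3 - a 0 * h1
    refine ⟨?_, ?_, ?_, ?_⟩
    · simp [hrow, h, hrow_zero]
    · simp [hcol, h]
    · ext i; fin_cases i <;> rfl
    · simp [hsum, h]

end FrameEpipolar

section FrameEpipolarField

variable {K : Type*} [Field K] {a b : Fin 3 → K}

theorem IsFrameEpipolar.exists_eq_hollowMatrix {F : Matrix (Fin 3) (Fin 3) K}
    (h : IsFrameEpipolar F a b) (hb : b 0 ≠ 0) : ∃ w, F = hollowMatrix b w := by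
  have hdiag (i : Fin 3) : F i i = 0 := congrFun h.diag_eq_zero i
  have hcol (j : Fin 3) := congrFun h.transpose_mulVec_eq_zero j
  simp only [mulVec, dotProduct, transpose_apply, Fin.sum_univ_three, Pi.zero_apply] at hcol
  refine ⟨![F 1 0, F 2 0, F 1 2 / b 0, F 2 1 / b 0], ?_⟩
  have h01 : F 0 1 = -(b 2 * (F 2 1 / b 0)) := by
    field_simp
    linear_combination hcol 1 - b 1 * hdiag 1
  have h02 : F 0 2 = -(b 1 * (F 1 2 / b 0)) := by
    field_simp
    linear_combination hcol 2 - b 2 * hdiag 2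
  ext i j
  fin_cases i <;> fin_cases j <;> simp [hollowMatrix, hdiag, h01, h02, mul_div_cancel₀, hb]

theorem exists_isFrameEpipolar_iff_of_apply_zero_ne_zero (hb : b 0 ≠ 0) :
    (∃ F, F ≠ 0 ∧ IsFrameEpipolar F a b) ↔ tripleForm a b = 0 := by
  have hollowMatrix_eq_zero_iff (w : Fin 4 → K) : hollowMatrix b w = 0 ↔ w = 0 := by
    simp only [hollowMatrix, ← ext_iff, funext_iff, Fin.forall_fin_succ, of_apply, cons_val',
      cons_val_fin_one, cons_val_zero, cons_val_succ, Matrix.zero_apply, Pi.zero_apply,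
      Fin.succ_zero_eq_one, Fin.succ_one_eq_two, Fin.reduceSucc, IsEmpty.forall_iff, neg_eq_zero,
      mul_eq_zero, hb, false_or, true_and, and_true]
    tauto
  calc (∃ F, F ≠ 0 ∧ IsFrameEpipolar F a b)
      ↔ ∃ w, hollowMatrix b w ≠ 0 ∧ IsFrameEpipolar (hollowMatrix b w) a b := by
        refine ⟨fun ⟨F, hF, h⟩ => ?_, fun ⟨w, hw⟩ => ⟨_, hw⟩⟩
        obtain ⟨w, rfl⟩ := h.exists_eq_hollowMatrix hb
        exact ⟨w, hF, h⟩
    _ ↔ ∃ w, w ≠ 0 ∧ frameSystem a b *ᵥ w = 0 := by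
        simp only [ne_eq, hollowMatrix_eq_zero_iff, isFrameEpipolar_hollowMatrix_iff hb]
    _ ↔ (frameSystem a b).det = 0 := exists_mulVec_eq_zero_iff
    _ ↔ tripleForm a b = 0 := by rw [det_frameSystem, mul_eq_zero, or_iff_right hb]

theorem exists_isFrameEpipolar_iff (hb : b ≠ 0) :
    (∃ F, F ≠ 0 ∧ IsFrameEpipolar F a b) ↔ tripleForm a b = 0 := by
  obtain ⟨k, hk⟩ := Function.ne_iff.1 hb
  rw [← exists_isFrameEpipolar_comp_iff (Equiv.addLeft k), ← tripleForm_comp_addLeft k]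
  exact exists_isFrameEpipolar_iff_of_apply_zero_ne_zero (by simpa using hk)

end FrameEpipolarField

theorem isFrameEpipolar_iff_frameVec {F : Matrix (Fin 3) (Fin 3) ℂ} {a b : Fin 3 → ℂ} :
    IsFrameEpipolar F a b ↔
      F *ᵥ a = 0 ∧ Fᵀ *ᵥ b = 0 ∧ ∀ i, frameVec i ⬝ᵥ (F *ᵥ frameVec i) = 0 := by
  rw [Fin.forall_fin_succ', frameVec_last]
  simp only [frameVec_castSucc, single_dotProduct, mulVec_single_one, one_mul, col_apply]
  exact ⟨fun h => ⟨h.1, h.2, congrFun h.3, h.4⟩, fun h => ⟨h.1, h.2.1, funext h.2.2.1, h.2.2.2⟩⟩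

section WeightedHomogeneous

variable {R σ τ M : Type*} [CommSemiring R] [AddCommMonoid M] {w : σ → M} {n : M}
  {f : MvPolynomial σ R}

theorem eval_monoidHom_mul_of_isWeightedHomogeneous (hf : IsWeightedHomogeneous w f n)
    (χ : Multiplicative M →* R) (c : σ → R) :
    eval (fun i => χ (.ofAdd (w i)) * c i) f = χ (.ofAdd n) * eval c f := by
  simp only [eval_eq, Finset.mul_sum]
  refine Finset.sum_congr rfl fun m hm => ?_
  have hχ : ∏ i ∈ m.support, χ (.ofAdd (w i)) ^ m i = χ (.ofAdd n) := by
    rw [← hf (mem_support_iff.1 hm), Finsupp.weight_apply, Finsupp.sum, ofAdd_sum, map_prod]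
    simp only [ofAdd_nsmul, map_pow]
  rw [Finset.prod_congr rfl fun i _ => mul_pow _ _ _, Finset.prod_mul_distrib, hχ, mul_left_comm]

theorem isWeightedHomogeneous_bind₁ {w' : τ → M} (hf : IsWeightedHomogeneous w f n)
    {φ : σ → MvPolynomial τ R} (hφ : ∀ i, IsWeightedHomogeneous w' (φ i) (w i)) :
    IsWeightedHomogeneous w' (bind₁ φ f) n := by
  rw [f.as_sum, map_sum]
  refine IsWeightedHomogeneous.sum _ _ _ fun m hm => ?_
  rw [bind₁_monomial, ← hf (mem_support_iff.1 hm), Finsupp.weight_apply]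
  exact (IsWeightedHomogeneous.prod _ _ _ fun i _ => (hφ i).pow (m i)).C_mul _

end WeightedHomogeneous

section LinSubst

variable {R σ τ : Type*} [CommRing R] [Fintype τ]

/-- The substitution of the linear forms given by the rows of `A` for the variables. -/
noncomputable def linSubst (A : Matrix σ τ R) : MvPolynomial σ R →ₐ[R] MvPolynomial τ R :=
  bind₁ A.toMvPolynomial

theorem eval_linSubst (A : Matrix σ τ R) (c : τ → R) (f : MvPolynomial σ R) :
    eval c (linSubst A f) = eval (A *ᵥ c) f := by
  rw [linSubst, eval, eval₂Hom_bind₁]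
  congr 2
  exact funext fun i => A.toMvPolynomial_eval_eq_apply i c

end LinSubst

theorem not_dvd_X_or_not_dvd_X_of_prime {R σ : Type*} [CommRing R] [IsDomain R]
    {f : MvPolynomial σ R} (hf : Prime f) {i j : σ} (hij : i ≠ j) : ¬ f ∣ X i ∨ ¬ f ∣ X j := by
  by_contra! h
  exact hij (X_dvd_X.1 ((hf.irreducible.dvd_symm X_prime.irreducible h.1).trans h.2))

section BiPoly

variable {f : BiPoly} {d e : ℕ} {a b : Fin 3 → ℂ}

theorem IsBihomogeneous.eval_smul_smul (hf : IsBihomogeneous f d e) (s t : ℂ)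
    (a b : Fin 3 → ℂ) :
    eval (Sum.elim (s • a) (t • b)) f = s ^ d * t ^ e * eval (Sum.elim a b) f := by
  let χ : Multiplicative (ℕ × ℕ) →* ℂ :=
    { toFun := fun p => s ^ p.toAdd.1 * t ^ p.toAdd.2
      map_one' := by simp
      map_mul' := fun p q => by simp only [toAdd_mul, Prod.fst_add, Prod.snd_add]; ring }
  change _ = χ (.ofAdd (d, e)) * _
  rw [← eval_monoidHom_mul_of_isWeightedHomogeneous hf χ]
  congr 2
  ext (i | i) <;> simp [χ]

theorem IsBihomogeneous.mk_mem_biZeroLocus_iff (hf : IsBihomogeneous f d e) (ha : a ≠ 0)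
    (hb : b ≠ 0) :
    (.mk ℂ a ha, .mk ℂ b hb) ∈ biZeroLocus f ↔ eval (Sum.elim a b) f = 0 := by
  obtain ⟨s, hs⟩ := Projectivization.exists_smul_eq_mk_rep ℂ a ha
  obtain ⟨t, ht⟩ := Projectivization.exists_smul_eq_mk_rep ℂ b hb
  rw [biZeroLocus, Set.mem_ofPred_eq, ← hs, ← ht, Units.smul_def, Units.smul_def,
    hf.eval_smul_smul, mul_eq_zero, or_iff_right (by simp)]

theorem mem_vanishingIdeal_biCone_iff {E : Set (P2 × P2)} :
    f ∈ vanishingIdeal ℂ (biCone E) ↔ ∀ (a b : Fin 3 → ℂ) (ha : a ≠ 0) (hb : b ≠ 0),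
      (.mk ℂ a ha, .mk ℂ b hb) ∈ E → eval (Sum.elim a b) f = 0 := by
  rw [mem_vanishingIdeal_iff]
  constructor
  · intro h a b ha hb hE
    exact h _ ⟨a, b, ha, hb, hE, rfl⟩
  · rintro h _ ⟨a, b, ha, hb, hE, rfl⟩
    exact h a b ha hb hE

theorem IsBihomogeneous.isEquationOf_biZeroLocus (hf : IsBihomogeneous f d e) (hprime : Prime f) :
    IsEquationOf f (biZeroLocus f) := by
  refine ⟨rfl, le_antisymm (fun p hp => ?_) ?_⟩
  · obtain ⟨i, hi⟩ : ∃ i : Fin 3, ¬ f ∣ X (.inl i) :=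
      (not_dvd_X_or_not_dvd_X_of_prime hprime (i := .inl 0) (j := .inl 1) (by simp)).elim
        (fun h => ⟨0, h⟩) fun h => ⟨1, h⟩
    obtain ⟨j, hj⟩ : ∃ j : Fin 3, ¬ f ∣ X (.inr j) :=
      (not_dvd_X_or_not_dvd_X_of_prime hprime (i := .inr 0) (j := .inr 1) (by simp)).elim
        (fun h => ⟨0, h⟩) fun h => ⟨1, h⟩
    have hspan : (Ideal.span {f}).IsPrime := (Ideal.span_singleton_prime hprime.ne_zero).2 hprime
    have hmem : p * X (.inl i) * X (.inr j) ∈ Ideal.span {f} := by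
      rw [← MvPolynomial.IsPrime.vanishingIdeal_zeroLocus (K := ℂ) (Ideal.span {f}),
        mem_vanishingIdeal_iff]
      intro c hc
      have hc0 : eval c f = 0 := by
        simpa [aeval_eq_eval] using hc _ (Ideal.mem_span_singleton_self f)
      obtain ⟨a, b, rfl⟩ : ∃ a b, c = Sum.elim a b := ⟨_, _, (Sum.elim_comp_inl_inr c).symm⟩
      simp only [aeval_eq_eval, map_mul, eval_X, Sum.elim_inl, Sum.elim_inr]
      by_cases ha : a = 0
      · simp [ha]
      by_cases hb : b = 0
      · simp [hb]
      rw [mem_vanishingIdeal_biCone_iff.1 hp a b ha hb ((hf.mk_mem_biZeroLocus_iff ha hb).2 hc0),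
        zero_mul, zero_mul]
    have hdvd : p * X (.inl i) ∈ Ideal.span {f} :=
      (hspan.mem_or_mem hmem).resolve_right (mt Ideal.mem_span_singleton.1 hj)
    exact (hspan.mem_or_mem hdvd).resolve_right (mt Ideal.mem_span_singleton.1 hi)
  · rw [Ideal.span_singleton_le_iff_mem, mem_vanishingIdeal_biCone_iff]
    exact fun a b ha hb => (hf.mk_mem_biZeroLocus_iff ha hb).1

end BiPoly

section StandardEquation

theorem map_tripleForm {R S : Type*} [CommRing R] [CommRing S] (φ : R →+* S) (a b : Fin 3 → R) :
    φ (tripleForm a b) = tripleForm (φ ∘ a) (φ ∘ b) := by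
  simp only [tripleForm_eq, map_add, map_sub, map_mul, Function.comp_apply]

theorem standardEquation_eq_tripleForm :
    standardEquation = tripleForm (fun i => X (.inl i)) fun i => X (.inr i) :=
  rfl

theorem eval_standardEquation (a b : Fin 3 → ℂ) :
    eval (Sum.elim a b) standardEquation = tripleForm a b := by
  rw [standardEquation_eq_tripleForm, map_tripleForm]
  congr 1 <;> ext i <;> simp

theorem isBihomogeneous_standardEquation : IsBihomogeneous standardEquation 2 2 := by
  have hl (i : Fin 3) : IsBihomogeneous (X (.inl i)) 1 0 := isWeightedHomogeneous_X ℂ _ _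
  have hr (i : Fin 3) : IsBihomogeneous (X (.inr i)) 0 1 := isWeightedHomogeneous_X ℂ _ _
  have hterm (i j k l m : Fin 3) : IsBihomogeneous
      (X (.inl i) * X (.inl j) * (X (.inr k) * (X (.inr l) - X (.inr m)))) 2 2 :=
    ((hl i).mul (hl j)).mul ((hr k).mul
      ((weightedHomogeneousSubmodule ℂ _ _).sub_mem (hr l) (hr m)))
  rw [standardEquation_eq_tripleForm, tripleForm_eq]
  exact ((hterm _ _ _ _ _).add (hterm _ _ _ _ _)).add (hterm _ _ _ _ _)

section Irreducible

variable {R σ : Type*} [CommRing R]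

theorem irreducible_X_sub_X [IsDomain R] {i j : σ} (hij : i ≠ j) :
    Irreducible (X i - X j : MvPolynomial σ R) := by
  have h := irreducible_mul_X_add (1 : MvPolynomial σ R) (-X j) i one_ne_zero (by simp)
    (by simpa [vars_neg, vars_X] using hij) isRelPrime_one_left
  rwa [one_mul, ← sub_eq_add_neg] at h

theorem isRelPrime_of_irreducible_of_eval {p q : MvPolynomial σ R} (hq : Irreducible q)
    (c : σ → R) (hqc : eval c q = 0) (hpc : eval c p ≠ 0) : IsRelPrime p q := by
  refine (hq.isRelPrime_iff_not_dvd.2 ?_).symm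
  rintro ⟨r, rfl⟩
  simp [hqc] at hpc

end Irreducible

theorem prime_standardEquation : Prime standardEquation := by
  have hirred {i : Fin 3 ⊕ Fin 3} : Irreducible (X i : BiPoly) := X_prime.irreducible
  set A : BiPoly := X (.inl 1) * (X (.inr 2) * (X (.inr 1) - X (.inr 0))) +
    X (.inl 2) * (X (.inr 1) * (X (.inr 0) - X (.inr 2)))
  set B : BiPoly := X (.inl 1) * (X (.inl 2) * (X (.inr 0) * (X (.inr 2) - X (.inr 1))))
  have heq : standardEquation = A * X (.inl 0) + B := by
    rw [standardEquation_eq_tripleForm, tripleForm_eq]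
    ring
  have notMem_vars {p : BiPoly} (hp : p ∈ supported ℂ {i | i ≠ Sum.inl 0}) :
      Sum.inl 0 ∉ p.vars := fun h => mem_supported.1 hp h rfl
  have hX {i : Fin 3 ⊕ Fin 3} (hi : i ≠ .inl 0) : (X i : BiPoly) ∈
      supported ℂ {i | i ≠ Sum.inl 0} := X_mem_supported.2 hi
  have hl1 := hX (i := .inl 1) (by simp)
  have hl2 := hX (i := .inl 2) (by simp)
  have hr (k : Fin 3) := hX (i := .inr k) (by simp)
  have hAB : IsRelPrime A B := by
    refine IsRelPrime.mul_right ?_ (.mul_right ?_ (.mul_right ?_ ?_))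
    · exact isRelPrime_of_irreducible_of_eval hirred (Sum.elim ![0, 0, 1] ![1, 1, 0])
        (by simp) (by simp [A])
    · exact isRelPrime_of_irreducible_of_eval hirred (Sum.elim ![0, 1, 0] ![0, 1, 1])
        (by simp) (by simp [A])
    · exact isRelPrime_of_irreducible_of_eval hirred (Sum.elim ![0, 1, 0] ![0, 1, 1])
        (by simp) (by simp [A])
    · exact isRelPrime_of_irreducible_of_eval (irreducible_X_sub_X (by simp))
        (Sum.elim ![0, 1, 0] ![0, 1, 1]) (by simp) (by simp [A])
  have hA0 : A ≠ 0 := fun h => by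
    simpa [A] using congrArg (eval (Sum.elim ![0, 1, 0] ![0, 1, 1])) h
  rw [← UniqueFactorizationMonoid.irreducible_iff_prime, heq]
  refine irreducible_mul_X_add A B _ hA0 (notMem_vars ?_) (notMem_vars ?_) hAB
  · exact add_mem (mul_mem hl1 (mul_mem (hr 2) (sub_mem (hr 1) (hr 0))))
      (mul_mem hl2 (mul_mem (hr 1) (sub_mem (hr 0) (hr 2))))
  · exact mul_mem hl1 (mul_mem hl2 (mul_mem (hr 0) (sub_mem (hr 2) (hr 1))))

theorem mk_mem_biZeroLocus_standardEquation_iff {a b : Fin 3 → ℂ} (ha : a ≠ 0) (hb : b ≠ 0) :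
    (.mk ℂ a ha, .mk ℂ b hb) ∈ biZeroLocus standardEquation ↔ tripleForm a b = 0 := by
  rw [isBihomogeneous_standardEquation.mk_mem_biZeroLocus_iff, eval_standardEquation]

theorem diag_mem_biZeroLocus_standardEquation (a : P2) :
    (a, a) ∈ biZeroLocus standardEquation := by
  induction a using Projectivization.ind with | h a ha =>
  rw [mk_mem_biZeroLocus_standardEquation_iff, tripleForm_self]

theorem cameraCenters_eq_biZeroLocus {x y : Fin 4 → P2} (hx : StandardPosition x)
    (hy : StandardPosition y) : cameraCenters x y = biZeroLocus standardEquation := by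
  obtain rfl : x = _ := funext hx
  obtain rfl : y = _ := funext hy
  ext ⟨a, b⟩
  induction a using Projectivization.ind with | h a ha =>
  induction b using Projectivization.ind with | h b hb =>
  rw [mk_mem_biZeroLocus_standardEquation_iff, ← exists_isFrameEpipolar_iff hb,
    mk_mem_cameraCenters_iff]
  simp only [isFrameEpipolar_iff_frameVec]

theorem isEquationOf_standardEquation :
    IsEquationOf standardEquation (biZeroLocus standardEquation) :=
  isBihomogeneous_standardEquation.isEquationOf_biZeroLocus prime_standardEquation

end StandardEquation

section Substitution

theorem isWeightedHomogeneous_toMvPolynomial {R σ τ M : Type*} [CommSemiring R] [Fintype τ]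
    [AddCommMonoid M] {A : Matrix σ τ R} {w : τ → M} {i : σ} {n : M}
    (h : ∀ j, A i j ≠ 0 → w j = n) : IsWeightedHomogeneous w (A.toMvPolynomial i) n := by
  refine IsWeightedHomogeneous.sum _ _ _ fun j _ => ?_
  by_cases hij : A i j = 0
  · rw [hij, monomial_zero]
    exact isWeightedHomogeneous_zero R w n
  · exact isWeightedHomogeneous_monomial w _ _ (by simp [Finsupp.weight_single, h j hij])

theorem eval_linSubst_fromBlocks {R σ τ σ' τ' : Type*} [CommRing R] [Fintype τ] [Fintype τ']
    (A : Matrix σ τ R) (B : Matrix σ' τ' R) (c : τ → R) (d : τ' → R)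
    (f : MvPolynomial (σ ⊕ σ') R) :
    eval (Sum.elim c d) (linSubst (fromBlocks A 0 0 B) f) =
      eval (Sum.elim (A *ᵥ c) (B *ᵥ d)) f := by
  rw [eval_linSubst, fromBlocks_mulVec, Sum.elim_comp_inl, Sum.elim_comp_inr, zero_mulVec,
    zero_mulVec, add_zero, zero_add]

variable {f : BiPoly} {d e : ℕ} {E : Set (P2 × P2)}

/-- The substitution of `g` applied to the first and `h` applied to the second three variables. -/
noncomputable def biSubst (g h : SL(3, ℂ)) : BiPoly →ₐ[ℂ] BiPoly :=
  linSubst (fromBlocks g.1 0 0 h.1)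

theorem eval_biSubst (g h : SL(3, ℂ)) (f : BiPoly) (a b : Fin 3 → ℂ) :
    eval (Sum.elim a b) (biSubst g h f) = eval (Sum.elim (g • a) (h • b)) f :=
  eval_linSubst_fromBlocks _ _ _ _ _

theorem biSubst_inv_biSubst (g h : SL(3, ℂ)) (f : BiPoly) :
    biSubst g⁻¹ h⁻¹ (biSubst g h f) = f := by
  refine MvPolynomial.funext fun c => ?_
  rw [← Sum.elim_comp_inl_inr c, eval_biSubst, eval_biSubst, smul_inv_smul, smul_inv_smul]

theorem biSubst_ne_zero (g h : SL(3, ℂ)) (hf : f ≠ 0) : biSubst g h f ≠ 0 := fun h0 =>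
  hf (by rw [← biSubst_inv_biSubst g h f, h0, map_zero])

theorem biSubst_dvd_iff {p : BiPoly} (g h : SL(3, ℂ)) :
    biSubst g h f ∣ p ↔ f ∣ biSubst g⁻¹ h⁻¹ p := by
  constructor <;> intro hdvd
  · simpa only [biSubst_inv_biSubst] using map_dvd (biSubst g⁻¹ h⁻¹) hdvd
  · have hp := biSubst_inv_biSubst g⁻¹ h⁻¹ p
    rw [inv_inv, inv_inv] at hp
    exact hp ▸ map_dvd (biSubst g h) hdvd

theorem IsBihomogeneous.biSubst (hf : IsBihomogeneous f d e) (g h : SL(3, ℂ)) :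
    IsBihomogeneous (biSubst g h f) d e := by
  refine isWeightedHomogeneous_bind₁ hf fun i => isWeightedHomogeneous_toMvPolynomial fun j => ?_
  rcases i with i | i <;> rcases j with j | j <;> simp

theorem IsBihomogeneous.biZeroLocus_biSubst (hf : IsBihomogeneous f d e) (g h : SL(3, ℂ)) :
    biZeroLocus (CameraCenters.biSubst g h f) =
      Prod.map (g • ·) (h • ·) ⁻¹' biZeroLocus f := by
  ext ⟨a, b⟩
  induction a using Projectivization.ind with | h a ha =>
  induction b using Projectivization.ind with | h b hb =>
  rw [(hf.biSubst g h).mk_mem_biZeroLocus_iff, Set.mem_preimage, Prod.map_apply,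
    Projectivization.smul_mk, Projectivization.smul_mk, hf.mk_mem_biZeroLocus_iff, eval_biSubst]

theorem biSubst_mem_vanishingIdeal_biCone_iff {p : BiPoly} (g h : SL(3, ℂ)) :
    biSubst g⁻¹ h⁻¹ p ∈ vanishingIdeal ℂ (biCone E) ↔
      p ∈ vanishingIdeal ℂ (biCone (Prod.map (g • ·) (h • ·) ⁻¹' E)) := by
  simp only [mem_vanishingIdeal_biCone_iff, eval_biSubst, Set.mem_preimage, Prod.map_apply,
    Projectivization.smul_mk]
  constructor
  · intro hp a b ha hb hE
    simpa only [inv_smul_smul] using hp _ _ _ _ hE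
  · intro hp a b ha hb hE
    refine hp _ _ ((smul_ne_zero_iff_ne g⁻¹).2 ha) ((smul_ne_zero_iff_ne h⁻¹).2 hb) ?_
    simpa only [smul_inv_smul] using hE

theorem IsEquationOf.preimage_smul (hE : IsEquationOf f E) (hf : IsBihomogeneous f d e)
    (g h : SL(3, ℂ)) : IsEquationOf (biSubst g h f) (Prod.map (g • ·) (h • ·) ⁻¹' E) := by
  refine ⟨by rw [hf.biZeroLocus_biSubst, ← hE.1], ?_⟩
  ext p
  rw [← biSubst_mem_vanishingIdeal_biCone_iff, hE.2, Ideal.mem_span_singleton,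
    Ideal.mem_span_singleton, biSubst_dvd_iff]

theorem IsHypersurfaceOfBidegree.preimage_smul (hE : IsHypersurfaceOfBidegree E d e)
    (g h : SL(3, ℂ)) : IsHypersurfaceOfBidegree (Prod.map (g • ·) (h • ·) ⁻¹' E) d e := by
  obtain ⟨f, hf0, hf, hfE⟩ := hE
  exact ⟨biSubst g h f, biSubst_ne_zero g h hf0, hf.biSubst g h, hfE.preimage_smul hf g h⟩

end Substitution

section Multidegree

variable {E : Set (P2 × P2)} {i j m : ℕ}

theorem dotProduct_rep_mk_eq_zero_iff {K ι : Type*} [Field K] [Fintype ι] {a : ι → K} (ha : a ≠ 0)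
    (u : ι → K) : u ⬝ᵥ (Projectivization.mk K a ha).rep = 0 ↔ u ⬝ᵥ a = 0 := by
  obtain ⟨s, hs⟩ := Projectivization.exists_smul_eq_mk_rep K a ha
  rw [← hs, dotProduct_smul, smul_eq_zero_iff_eq]

theorem dotProduct_smul_rep_eq_zero_iff {K : Type*} [Field K] {n : ℕ} (g : SL(n, K))
    (u : Fin n → K) (p : ℙ K (Fin n → K)) :
    (g⁻¹.1ᵀ *ᵥ u) ⬝ᵥ (g • p).rep = 0 ↔ u ⬝ᵥ p.rep = 0 := by
  induction p using Projectivization.ind with | h a ha =>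
  rw [Projectivization.smul_mk, dotProduct_rep_mk_eq_zero_iff, dotProduct_rep_mk_eq_zero_iff,
    mulVec_transpose, ← dotProduct_mulVec, ← specialLinearGroup_smul_eq, inv_smul_smul]

theorem slice_preimage_smul (E : Set (P2 × P2)) (g h : SL(3, ℂ)) (u : Fin i → Fin 3 → ℂ)
    (v : Fin j → Fin 3 → ℂ) :
    slice (Prod.map (g • ·) (h • ·) ⁻¹' E) u v = Prod.map (g • ·) (h • ·) ⁻¹'
      slice E (fun k => g⁻¹.1ᵀ *ᵥ u k) (fun l => h⁻¹.1ᵀ *ᵥ v l) := by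
  ext p
  simp only [slice, Set.mem_preimage, Set.mem_ofPred_eq, Prod.map_fst, Prod.map_snd,
    dotProduct_smul_rep_eq_zero_iff]

theorem one_kronecker_mulVec {R ι l n : Type*} [CommRing R] [Fintype ι] [DecidableEq ι]
    [Fintype n] (A : Matrix l n R) (u : ι → n → R) :
    ((1 : Matrix ι ι R) ⊗ₖ A) *ᵥ (fun t => u t.1 t.2) = fun t => (A *ᵥ u t.1) t.2 := by
  have h := kronecker_mulVec_vec A (of u)ᵀ (1 : Matrix ι ι R)
  rw [transpose_one, Matrix.mul_one] at h
  exact h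

theorem HasMultidegree.preimage_smul (hE : HasMultidegree E i j m) (g h : SL(3, ℂ)) :
    HasMultidegree (Prod.map (g • ·) (h • ·) ⁻¹' E) i j m := by
  obtain ⟨G, hG, hslice⟩ := hE
  let A : SL(3, ℂ) → Matrix (Fin 3) (Fin 3) ℂ := fun k => k⁻¹.1ᵀ
  have eval_subst (u : Fin i → Fin 3 → ℂ) (v : Fin j → Fin 3 → ℂ) :
      eval (Sum.elim (fun t => u t.1 t.2) fun t => v t.1 t.2)
        (linSubst (fromBlocks (1 ⊗ₖ A g) 0 0 (1 ⊗ₖ A h)) G) =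
      eval (Sum.elim (fun t => (A g *ᵥ u t.1) t.2) fun t => (A h *ᵥ v t.1) t.2) G := by
    rw [eval_linSubst_fromBlocks, one_kronecker_mulVec, one_kronecker_mulVec]
  refine ⟨linSubst (fromBlocks (1 ⊗ₖ A g) 0 0 (1 ⊗ₖ A h)) G, fun h0 => hG ?_, fun u v huv => ?_⟩
  · refine MvPolynomial.funext fun c => ?_
    have hA (k : SL(3, ℂ)) (w : Fin 3 → ℂ) : A k *ᵥ (k.1ᵀ *ᵥ w) = w := by
      rw [mulVec_mulVec, ← transpose_mul, ← Matrix.SpecialLinearGroup.coe_mul, mul_inv_cancel,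
        Matrix.SpecialLinearGroup.coe_one, transpose_one, one_mulVec]
    have heval := eval_subst (fun r => g.1ᵀ *ᵥ fun s => c (.inl (r, s)))
      (fun r => h.1ᵀ *ᵥ fun s => c (.inr (r, s)))
    rw [h0, map_zero] at heval
    simp only [hA] at heval
    rw [map_zero, heval, ← Sum.elim_comp_inl_inr c]
    rfl
  · rw [slice_preimage_smul, Set.encard_preimage_of_bijective
      ((MulAction.bijective g).prodMap (MulAction.bijective h))]
    exact hslice _ _ (eval_subst u v ▸ huv)

theorem HasMultidegree.preimage_swap (hE : HasMultidegree E i j m) :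
    HasMultidegree (Prod.swap ⁻¹' E) j i m := by
  obtain ⟨G, hG, hslice⟩ := hE
  refine ⟨rename Sum.swap G, (map_ne_zero_iff _ (rename_injective _
    Sum.swap_leftInverse.injective)).2 hG, fun u v huv => ?_⟩
  have hslice_swap : slice (Prod.swap ⁻¹' E) u v = Prod.swap ⁻¹' slice E v u := by
    ext p
    simp only [slice, Set.mem_preimage, Set.mem_ofPred_eq, Prod.fst_swap, Prod.snd_swap]
    exact and_congr_right' and_comm
  rw [hslice_swap, Set.encard_preimage_of_bijective Prod.swap_bijective]
  refine hslice v u ?_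
  rwa [eval_rename, Sum.elim_swap] at huv

end Multidegree

section LineConic

section CommRing

variable {R : Type*} [CommRing R]

theorem cross_dotProduct_smul (p q n r : Fin 3 → R) :
    (p ⨯₃ q ⬝ᵥ n) • r =
      (r ⨯₃ q ⬝ᵥ n) • p + (p ⨯₃ r ⬝ᵥ n) • q + (p ⨯₃ q ⬝ᵥ r) • n := by
  ext i
  fin_cases i <;>
  · simp only [cross_apply, vec3_dotProduct, Pi.smul_apply, Pi.add_apply, smul_eq_mul, cons_val,
      cons_val_zero, cons_val_one, Fin.reduceFinMk, Fin.zero_eta, Fin.mk_one]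
    ring

theorem smul_add_smul_dotProduct_mulVec_self {n : Type*} [Fintype n] {S : Matrix n n R}
    (hS : S.IsSymm) (p q : n → R) (s t : R) :
    (s • p + t • q) ⬝ᵥ (S *ᵥ (s • p + t • q)) =
      p ⬝ᵥ (S *ᵥ p) * s ^ 2 + 2 * (p ⬝ᵥ (S *ᵥ q)) * s * t + q ⬝ᵥ (S *ᵥ q) * t ^ 2 := by
  have hqp : q ⬝ᵥ (S *ᵥ p) = p ⬝ᵥ (S *ᵥ q) := by
    rw [dotProduct_mulVec, ← mulVec_transpose, hS.eq, dotProduct_comm]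
  simp only [mulVec_add, mulVec_smul, add_dotProduct, dotProduct_add, smul_dotProduct,
    dotProduct_smul, smul_eq_mul, hqp]
  ring

theorem cross_dotProduct_adjugate_mulVec_cross {S : Matrix (Fin 3) (Fin 3) R} (hS : S.IsSymm)
    (p q : Fin 3 → R) :
    (p ⨯₃ q) ⬝ᵥ (S.adjugate *ᵥ (p ⨯₃ q)) =
      p ⬝ᵥ (S *ᵥ p) * q ⬝ᵥ (S *ᵥ q) - (p ⬝ᵥ (S *ᵥ q)) ^ 2 := by
  have h10 := hS.apply 0 1
  have h20 := hS.apply 0 2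
  have h21 := hS.apply 1 2
  simp only [adjugate_fin_three, mulVec, vec3_dotProduct, cross_apply, of_apply, cons_val',
    cons_val_zero, cons_val_one, cons_val, cons_val_fin_one, h10, h20, h21]
  ring

end CommRing

theorem exists_binaryForm_eq_zero {K : Type*} [Field K] [IsAlgClosed K] [NeZero (2 : K)]
    (α β γ : K) : ∃ s t : K, (s ≠ 0 ∨ t ≠ 0) ∧ α * s ^ 2 + β * s * t + γ * t ^ 2 = 0 := by
  by_cases hα : α = 0
  · exact ⟨1, 0, by simp [hα]⟩
  · obtain ⟨s, hs⟩ := exists_quadratic_eq_zero hα (IsAlgClosed.exists_eq_mul_self (discrim α β γ))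
    exact ⟨s, 1, by simp, by linear_combination hs⟩

section Field

variable {K : Type*} [Field K] {p q r v : Fin 3 → K}

theorem exists_dotProduct_eq_zero_and_cross_eq (hp : p ≠ 0) (hv : v ⬝ᵥ p = 0) :
    ∃ w, v ⬝ᵥ w = 0 ∧ p ⨯₃ w = v := by
  obtain ⟨k, hk⟩ := Function.ne_iff.1 hp
  refine ⟨v ⨯₃ Pi.single k (p k)⁻¹, dot_self_cross _ _, ?_⟩
  rw [cross_cross_eq_smul_sub_smul', dotProduct_single, mul_inv_cancel₀ hk, hv, one_smul,
    zero_smul, sub_zero]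

theorem exists_eq_smul_add_smul_of_cross_ne_zero (hpq : p ⨯₃ q ≠ 0) (hr : p ⨯₃ q ⬝ᵥ r = 0) :
    ∃ s t : K, r = s • p + t • q := by
  obtain ⟨k, hk⟩ := Function.ne_iff.1 hpq
  have h := cross_dotProduct_smul p q (Pi.single k ((p ⨯₃ q) k)⁻¹) r
  rw [dotProduct_single, mul_inv_cancel₀ hk, one_smul, hr, zero_smul, add_zero] at h
  exact ⟨_, _, h⟩

theorem smul_add_smul_ne_zero_of_cross_ne_zero (hpq : p ⨯₃ q ≠ 0) {s t : K}
    (hst : s ≠ 0 ∨ t ≠ 0) : s • p + t • q ≠ 0 := by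
  intro h
  have hs := congrArg (· ⨯₃ q) h
  have ht := congrArg (p ⨯₃ ·) h
  simp only [map_add, map_smul, LinearMap.add_apply, LinearMap.smul_apply, cross_self, map_zero,
    LinearMap.zero_apply, smul_zero, add_zero, zero_add, smul_eq_zero, hpq, or_false] at hs ht
  exact hst.elim (· hs) (· ht)

theorem exists_isotropic_of_dotProduct_eq_zero [IsAlgClosed K] [NeZero (2 : K)]
    {S : Matrix (Fin 3) (Fin 3) K} (hS : S.IsSymm) (hv : v ≠ 0) :
    ∃ p, p ≠ 0 ∧ v ⬝ᵥ p = 0 ∧ p ⬝ᵥ (S *ᵥ p) = 0 := by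
  obtain ⟨q, hq, hvq⟩ := exists_mulVec_eq_zero_iff.2
    (det_zero_of_row_eq (M := of fun _ : Fin 3 => v) zero_ne_one rfl)
  replace hvq : v ⬝ᵥ q = 0 := congrFun hvq 0
  obtain ⟨w, hvw, hqw⟩ := exists_dotProduct_eq_zero_and_cross_eq hq hvq
  obtain ⟨s, t, hst, hform⟩ := exists_binaryForm_eq_zero (q ⬝ᵥ (S *ᵥ q)) (2 * (q ⬝ᵥ (S *ᵥ w)))
    (w ⬝ᵥ (S *ᵥ w))
  exact ⟨s • q + t • w, smul_add_smul_ne_zero_of_cross_ne_zero (hqw ▸ hv) hst,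
    by simp [hvq, hvw], (smul_add_smul_dotProduct_mulVec_self hS q w s t).trans hform⟩

theorem exists_isotropic_iff_cross_eq_zero [IsAlgClosed K] [NeZero (2 : K)]
    {S : Matrix (Fin 3) (Fin 3) K} (hS : S.IsSymm) (hv : v ⬝ᵥ (S.adjugate *ᵥ v) ≠ 0) :
    ∃ p q, p ⨯₃ q ≠ 0 ∧ v ⬝ᵥ p = 0 ∧ v ⬝ᵥ q = 0 ∧
      ∀ r, v ⬝ᵥ r = 0 → (r ⬝ᵥ (S *ᵥ r) = 0 ↔ r ⨯₃ p = 0 ∨ r ⨯₃ q = 0) := by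
  have hv0 : v ≠ 0 := by
    rintro rfl
    exact hv (zero_dotProduct _)
  obtain ⟨p, hp, hvp, hSp⟩ := exists_isotropic_of_dotProduct_eq_zero hS hv0
  obtain ⟨w, hvw, hpw⟩ := exists_dotProduct_eq_zero_and_cross_eq hp hvp
  set β := p ⬝ᵥ (S *ᵥ w)
  set γ := w ⬝ᵥ (S *ᵥ w)
  have hβ : β ≠ 0 := by
    rw [← hpw, cross_dotProduct_adjugate_mulVec_cross hS, hSp, zero_mul, zero_sub] at hv
    exact pow_ne_zero_iff two_ne_zero |>.1 (neg_ne_zero.1 hv)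
  refine ⟨p, γ • p - (2 * β) • w, ?_, hvp, ?_, fun r hvr => ?_⟩
  · simpa [hpw, hβ, hv0] using NeZero.ne (2 : K)
  · simp [hvp, hvw]
  · obtain ⟨s, t, rfl⟩ := exists_eq_smul_add_smul_of_cross_ne_zero (hpw ▸ hv0) (hpw ▸ hvr)
    have hwp : w ⨯₃ p = -v := by rw [← cross_anticomm, hpw]
    have hform : (s • p + t • w) ⬝ᵥ (S *ᵥ (s • p + t • w)) = t * (2 * β * s + γ * t) := by
      rw [smul_add_smul_dotProduct_mulVec_self hS, hSp]
      ring
    have hcross_p : (s • p + t • w) ⨯₃ p = -t • v := by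
      simp [hwp]
    have hcross_q : (s • p + t • w) ⨯₃ (γ • p - (2 * β) • w) = -(2 * β * s + γ * t) • v := by
      simp only [map_sub, map_add, map_smul, LinearMap.add_apply, LinearMap.smul_apply,
        cross_self, hpw, hwp]
      module
    rw [hform, hcross_p, hcross_q, mul_eq_zero, neg_smul, neg_smul, neg_eq_zero, neg_eq_zero,
      smul_eq_zero_iff_left hv0, smul_eq_zero_iff_left hv0]

end Field

theorem mk_mem_quadric_iff {M : Matrix (Fin 3) (Fin 3) ℂ} {a : Fin 3 → ℂ} (ha : a ≠ 0) :
    .mk ℂ a ha ∈ quadric M ↔ a ⬝ᵥ (M *ᵥ a) = 0 := by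
  obtain ⟨s, hs⟩ := Projectivization.exists_smul_eq_mk_rep ℂ a ha
  rw [quadric, Set.mem_ofPred_eq, ← hs, mulVec_smul, dotProduct_smul, smul_dotProduct,
    smul_eq_zero_iff_eq, smul_eq_zero_iff_eq]

theorem encard_line_inter_quadric {S : Matrix (Fin 3) (Fin 3) ℂ} (hS : S.IsSymm)
    {v : Fin 3 → ℂ} (hv : v ⬝ᵥ (S.adjugate *ᵥ v) ≠ 0) :
    ({p : P2 | v ⬝ᵥ p.rep = 0} ∩ quadric S).encard = 2 := by
  obtain ⟨p, q, hpq, hvp, hvq, isotropic_iff⟩ := exists_isotropic_iff_cross_eq_zero hS hv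
  have hp : p ≠ 0 := by rintro rfl; simp at hpq
  have hq : q ≠ 0 := by rintro rfl; simp at hpq
  have hne : Projectivization.mk ℂ p hp ≠ .mk ℂ q hq := by
    rwa [ne_eq, Projectivization.mk_eq_mk_iff_crossProduct_eq_zero]
  rw [← Set.encard_pair hne]
  congr 1
  have mk_mem_iff {r : Fin 3 → ℂ} (hr : r ≠ 0) :
      .mk ℂ r hr ∈ {p : P2 | v ⬝ᵥ p.rep = 0} ∩ quadric S ↔ v ⬝ᵥ r = 0 ∧ r ⬝ᵥ (S *ᵥ r) = 0 :=
    and_congr (dotProduct_rep_mk_eq_zero_iff hr v) (mk_mem_quadric_iff hr)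
  refine Set.Subset.antisymm (fun r hr => ?_) (Set.pair_subset ?_ ?_)
  · induction r using Projectivization.ind with | h r hr0 =>
    obtain ⟨hvr, hSr⟩ := (mk_mem_iff hr0).1 hr
    exact ((isotropic_iff r hvr).1 hSr).imp
      (Projectivization.mk_eq_mk_iff_crossProduct_eq_zero hr0 hp).2
      (Projectivization.mk_eq_mk_iff_crossProduct_eq_zero hr0 hq).2
  · exact (mk_mem_iff hp).2 ⟨hvp, (isotropic_iff p hvp).2 (.inl (cross_self p))⟩
  · exact (mk_mem_iff hq).2 ⟨hvq, (isotropic_iff q hvq).2 (.inr (cross_self q))⟩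

end LineConic

section Independence

theorem independent_mk_iff {ι K V : Type*} [Field K] [AddCommGroup V] [Module K V] {u : ι → V}
    (hu : ∀ i, u i ≠ 0) :
    Projectivization.Independent (fun i => .mk K (u i) (hu i)) ↔ LinearIndependent K u := by
  choose c hc using fun i => Projectivization.exists_smul_eq_mk_rep K (u i) (hu i)
  rw [Projectivization.independent_iff, ← LinearIndependent.units_smul_iff u c]
  have hrep : Projectivization.rep ∘ (fun i => .mk K (u i) (hu i)) = c • u :=
    funext fun i => (hc i).symm
  rw [hrep]

theorem independent_smul_iff {G ι K V : Type*} [Field K] [AddCommGroup V] [Module K V] [Group G]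
    [DistribMulAction G V] [SMulCommClass G K V] (g : G) {x : ι → ℙ K V} :
    Projectivization.Independent (g • x) ↔ Projectivization.Independent x := by
  obtain ⟨u, hu, rfl⟩ := exists_eq_mk x
  refine (independent_mk_iff _).trans (Iff.trans ?_ (independent_mk_iff hu).symm)
  exact (DistribMulAction.toLinearEquiv K V g).toLinearMap.linearIndependent_iff
    (DistribMulAction.toLinearEquiv K V g).ker

theorem independent_mk_triple_iff {K : Type*} [Field K] {u v w : Fin 3 → K} (hu : u ≠ 0)
    (hv : v ≠ 0) (hw : w ≠ 0) :
    Projectivization.Independent ![.mk K u hu, .mk K v hv, .mk K w hw] ↔ u ⨯₃ v ⬝ᵥ w ≠ 0 := by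
  have hne : ∀ i, ![u, v, w] i ≠ 0 := by
    simp [Fin.forall_fin_succ, hu, hv, hw]
  have hmk : ![Projectivization.mk K u hu, .mk K v hv, .mk K w hw] =
      fun i => .mk K (![u, v, w] i) (hne i) := by
    ext i
    fin_cases i <;> rfl
  rw [hmk, independent_mk_iff, dotProduct_comm, ← triple_product_permutation,
    ← triple_product_permutation, triple_product_eq_det]
  exact (linearIndependent_rows_iff_isUnit (A := of ![u, v, w])).trans
    ((isUnit_iff_isUnit_det _).trans isUnit_iff_ne_zero)

theorem OffLines.smul {n : ℕ} {x : Fin n → P2} {p : P2} (hp : OffLines x p) (g : SL(3, ℂ)) :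
    OffLines (g • x) (g • p) := by
  intro i j hij
  have hsmul : ![(g • x) i, (g • x) j, g • p] = g • ![x i, x j, p] := by
    ext k
    fin_cases k <;> rfl
  rw [hsmul, independent_smul_iff]
  exact hp i j hij

end Independence

section Quadric

variable {Q : Set P2}

theorem preimage_smul_quadric (M : Matrix (Fin 3) (Fin 3) ℂ) (g : SL(3, ℂ)) :
    (g • ·) ⁻¹' quadric M = quadric (g.1ᵀ * M * g.1) := by
  ext p
  induction p using Projectivization.ind with | h a ha =>
  rw [Set.mem_preimage, Projectivization.smul_mk, mk_mem_quadric_iff, mk_mem_quadric_iff,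
    ← mulVec_mulVec, ← mulVec_mulVec, dotProduct_mulVec a, vecMul_transpose]
  rfl

theorem isSymm_transpose_mul_mul {n R : Type*} [Fintype n] [CommRing R] {M : Matrix n n R}
    (hM : M.IsSymm) (A : Matrix n n R) : (Aᵀ * M * A).IsSymm := by
  rw [IsSymm, transpose_mul, transpose_mul, transpose_transpose, hM.eq, Matrix.mul_assoc]

theorem IsConic.preimage_smul (hQ : IsConic Q) (g : SL(3, ℂ)) : IsConic ((g • ·) ⁻¹' Q) := by
  obtain ⟨M, hM, hrank, rfl⟩ := hQ
  refine ⟨_, isSymm_transpose_mul_mul hM g.1, ?_, preimage_smul_quadric M g⟩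
  rwa [rank_mul_eq_left_of_isUnit_det _ _ (by simp), rank_mul_eq_right_of_isUnit_det _ _ (by simp)]

theorem IsNondegenerateConic.preimage_smul (hQ : IsNondegenerateConic Q) (g : SL(3, ℂ)) :
    IsNondegenerateConic ((g • ·) ⁻¹' Q) := by
  obtain ⟨M, hM, hdet, rfl⟩ := hQ
  exact ⟨_, isSymm_transpose_mul_mul hM g.1, by simpa using hdet, preimage_smul_quadric M g⟩

end Quadric

section FiberMatrix

variable {R : Type*} [CommRing R]

/-- The symmetric matrix of the quadratic form `b ↦ 2 * tripleForm a b`. -/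
def fiberMatrix (a : Fin 3 → R) : Matrix (Fin 3) (Fin 3) R :=
  !![0, a 2 * (a 0 - a 1), a 1 * (a 2 - a 0);
     a 2 * (a 0 - a 1), 0, a 0 * (a 1 - a 2);
     a 1 * (a 2 - a 0), a 0 * (a 1 - a 2), 0]

theorem isSymm_fiberMatrix (a : Fin 3 → R) : (fiberMatrix a).IsSymm :=
  IsSymm.ext fun i j => by fin_cases i <;> fin_cases j <;> rfl

theorem diag_fiberMatrix (a : Fin 3 → R) : (fiberMatrix a).diag = 0 := by
  ext i; fin_cases i <;> rfl

theorem dotProduct_fiberMatrix_mulVec_self (a b : Fin 3 → R) :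
    b ⬝ᵥ (fiberMatrix a *ᵥ b) = 2 * tripleForm a b := by
  simp only [tripleForm_eq, fiberMatrix, mulVec, vec3_dotProduct, of_apply, cons_val]
  ring

theorem det_fiberMatrix (a : Fin 3 → R) :
    (fiberMatrix a).det = 2 * (a 0 * a 1 * a 2 * ((a 0 - a 1) * (a 1 - a 2) * (a 2 - a 0))) := by
  simp only [fiberMatrix, det_fin_three, of_apply, cons_val]
  ring

theorem fiberMatrix_zero : fiberMatrix (0 : Fin 3 → R) = 0 := by
  ext i j; fin_cases i <;> fin_cases j <;> simp [fiberMatrix]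

theorem map_fiberMatrix {S : Type*} [CommRing S] (φ : R →+* S) (a : Fin 3 → R) :
    (fiberMatrix a).map φ = fiberMatrix (φ ∘ a) := by
  ext i j; fin_cases i <;> fin_cases j <;> simp [fiberMatrix]

theorem two_le_rank_of_isSymm_of_diag_eq_zero {n K : Type*} [Fintype n] [Field K]
    {M : Matrix n n K} (hM : M.IsSymm) (hdiag : M.diag = 0) (h0 : M ≠ 0) : 2 ≤ M.rank := by
  obtain ⟨i, j, hij⟩ : ∃ i j, M i j ≠ 0 := by
    by_contra! h
    exact h0 (ext h)
  have hdet : (M.submatrix ![i, j] ![i, j]).det = -M i j ^ 2 := by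
    have hii : M i i = 0 := congrFun hdiag i
    simp only [det_fin_two, submatrix_apply, cons_val_zero, cons_val_one, hii, hM.apply i j]
    ring
  have hunit : IsUnit (M.submatrix ![i, j] ![i, j]) := by
    rw [isUnit_iff_isUnit_det, hdet, isUnit_iff_ne_zero]
    exact neg_ne_zero.2 (pow_ne_zero 2 hij)
  calc 2 = (M.submatrix ![i, j] ![i, j]).rank := by rw [rank_of_isUnit _ hunit, Fintype.card_fin]
    _ ≤ M.rank := rank_submatrix_le M _ _

theorem exists_eq_smul_frameVec_of_fiberMatrix_eq_zero {a : Fin 3 → ℂ}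
    (h : fiberMatrix a = 0) : ∃ i, ∃ c : ℂ, a = c • frameVec i := by
  have h02 : a 1 * (a 2 - a 0) = 0 := congrFun₂ h 0 2
  have h12 : a 0 * (a 1 - a 2) = 0 := congrFun₂ h 1 2
  by_cases h0 : a 0 = 0
  · by_cases h1 : a 1 = 0
    · refine ⟨2, a 2, funext fun k => ?_⟩
      fin_cases k <;> simp [frameVec, h0, h1]
    · have h2 : a 2 = 0 := by simpa [h0, h1] using h02
      refine ⟨1, a 1, funext fun k => ?_⟩
      fin_cases k <;> simp [frameVec, h0, h2]
  · have h12' : a 1 = a 2 := by simpa [h0, sub_eq_zero] using h12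
    by_cases h1 : a 1 = 0
    · refine ⟨0, a 0, funext fun k => ?_⟩
      fin_cases k <;> simp [frameVec, h1, ← h12']
    · have h02' : a 2 = a 0 := by simpa [h1, sub_eq_zero] using h02
      refine ⟨3, a 0, funext fun k => ?_⟩
      fin_cases k <;> simp [frameVec, h12', h02']

theorem det_fiberMatrix_ne_zero {a : Fin 3 → ℂ}
    (h : ∀ i j, i ≠ j → frameVec i ⨯₃ frameVec j ⬝ᵥ a ≠ 0) : (fiberMatrix a).det ≠ 0 := by
  simp only [vec3_dotProduct] at h
  simp only [cross_apply, frameVec, cons_val] at h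
  have h0 : a 0 ≠ 0 := by simpa using h 1 2 (by decide)
  have h1 : a 1 ≠ 0 := by simpa using h 2 0 (by decide)
  have h2 : a 2 ≠ 0 := by simpa using h 0 1 (by decide)
  have h01 : a 0 - a 1 ≠ 0 := by simpa [sub_eq_add_neg] using h 3 2 (by decide)
  have h12 : a 1 - a 2 ≠ 0 := by simpa [sub_eq_add_neg] using h 3 0 (by decide)
  have h20 : a 2 - a 0 ≠ 0 := by simpa [sub_eq_neg_add] using h 3 1 (by decide)
  rw [det_fiberMatrix]
  exact mul_ne_zero two_ne_zero (mul_ne_zero (mul_ne_zero (mul_ne_zero h0 h1) h2)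
    (mul_ne_zero (mul_ne_zero h01 h12) h20))

end FiberMatrix

section Fiber

variable {E : Set (P2 × P2)} {x y : Fin 4 → P2}

theorem mem_fiberOverFst_iff {a b : P2} : b ∈ fiberOverFst E a ↔ (a, b) ∈ E := by
  simp [fiberOverFst]

theorem fiberOverFst_preimage_smul (g h : SL(3, ℂ)) (a : P2) :
    fiberOverFst (Prod.map (g • ·) (h • ·) ⁻¹' E) a = (h • ·) ⁻¹' fiberOverFst E (g • a) := by
  ext b
  simp only [Set.mem_preimage, mem_fiberOverFst_iff, Prod.map_apply]

theorem fiberOverFst_preimage_swap (b : P2) :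
    fiberOverFst (Prod.swap ⁻¹' E) b = fiberOverSnd E b := by
  ext a
  simp [fiberOverFst, fiberOverSnd]

theorem fiberOverFst_biZeroLocus_standardEquation {a : Fin 3 → ℂ} (ha : a ≠ 0) :
    fiberOverFst (biZeroLocus standardEquation) (.mk ℂ a ha) = quadric (fiberMatrix a) := by
  ext b
  induction b using Projectivization.ind with | h b hb =>
  rw [mem_fiberOverFst_iff, mk_mem_biZeroLocus_standardEquation_iff, mk_mem_quadric_iff,
    dotProduct_fiberMatrix_mulVec_self, mul_eq_zero_iff_left two_ne_zero]

theorem StandardPosition.isConic_fiberOverFst (hx : StandardPosition x) {a : P2}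
    (ha : ∀ i, a ≠ x i) : IsConic (fiberOverFst (biZeroLocus standardEquation) a) := by
  induction a using Projectivization.ind with | h a ha₀ =>
  refine ⟨fiberMatrix a, isSymm_fiberMatrix a, ?_, fiberOverFst_biZeroLocus_standardEquation ha₀⟩
  refine two_le_rank_of_isSymm_of_diag_eq_zero (isSymm_fiberMatrix a) (diag_fiberMatrix a) ?_
  intro h
  obtain ⟨i, c, rfl⟩ := exists_eq_smul_frameVec_of_fiberMatrix_eq_zero h
  exact ha i (((Projectivization.mk_eq_mk_iff' ℂ _ _ _ _).2 ⟨c, rfl⟩).trans (hx i).symm)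

theorem StandardPosition.isNondegenerateConic_fiberOverFst (hx : StandardPosition x) {a : P2}
    (ha : OffLines x a) :
    IsNondegenerateConic (fiberOverFst (biZeroLocus standardEquation) a) := by
  induction a using Projectivization.ind with | h a ha₀ =>
  refine ⟨fiberMatrix a, isSymm_fiberMatrix a, det_fiberMatrix_ne_zero fun i j hij => ?_,
    fiberOverFst_biZeroLocus_standardEquation ha₀⟩
  have hind := ha i j hij
  rwa [hx i, hx j, independent_mk_triple_iff] at hind

end Fiber

section SliceDiscriminant

theorem map_crossProduct {R S : Type*} [CommRing R] [CommRing S] (φ : R →+* S) (u v : Fin 3 → R) :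
    φ ∘ (u ⨯₃ v) = (φ ∘ u) ⨯₃ (φ ∘ v) := by
  ext i
  fin_cases i <;> simp [cross_apply]

/-- The value at `v` of the dual quadratic form of `fiberMatrix a`, where `a = u₁ × u₂` is the
common point of the lines `u₁` and `u₂`. It is nonzero iff the line `v` meets the conic over `a` in
exactly two points. -/
def sliceDiscriminant {R : Type*} [CommRing R] (u₁ u₂ v : Fin 3 → R) : R :=
  v ⬝ᵥ ((fiberMatrix (u₁ ⨯₃ u₂)).adjugate *ᵥ v)

theorem map_sliceDiscriminant {R S : Type*} [CommRing R] [CommRing S] (φ : R →+* S)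
    (u₁ u₂ v : Fin 3 → R) :
    φ (sliceDiscriminant u₁ u₂ v) = sliceDiscriminant (φ ∘ u₁) (φ ∘ u₂) (φ ∘ v) := by
  have hmulVec (A : Matrix (Fin 3) (Fin 3) R) : φ ∘ (A *ᵥ v) = A.map φ *ᵥ (φ ∘ v) :=
    funext (φ.map_mulVec A v)
  rw [sliceDiscriminant, RingHom.map_dotProduct, hmulVec, ← RingHom.mapMatrix_apply,
    RingHom.map_adjugate, RingHom.mapMatrix_apply, map_fiberMatrix, map_crossProduct,
    sliceDiscriminant]

theorem mk_cross_eq_iff {K : Type*} [Field K] {u₁ u₂ : Fin 3 → K} (hu : u₁ ⨯₃ u₂ ≠ 0)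
    (p : ℙ K (Fin 3 → K)) :
    p = .mk K (u₁ ⨯₃ u₂) hu ↔ u₁ ⬝ᵥ p.rep = 0 ∧ u₂ ⬝ᵥ p.rep = 0 := by
  induction p using Projectivization.ind with | h a ha =>
  rw [dotProduct_rep_mk_eq_zero_iff, dotProduct_rep_mk_eq_zero_iff, eq_comm,
    Projectivization.mk_eq_mk_iff_crossProduct_eq_zero, cross_cross_eq_smul_sub_smul]
  refine ⟨fun h => ?_, fun ⟨h₁, h₂⟩ => by simp [h₁, h₂]⟩
  constructor
  · simpa [hu] using congrArg (u₁ ⨯₃ ·) h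
  · simpa [hu] using congrArg (· ⨯₃ u₂) h

theorem slice_eq_singleton_prod {E : Set (P2 × P2)} {u : Fin 2 → Fin 3 → ℂ}
    (hu : u 0 ⨯₃ u 1 ≠ 0) (v : Fin 1 → Fin 3 → ℂ) :
    slice E u v = {Projectivization.mk ℂ (u 0 ⨯₃ u 1) hu} ×ˢ
      ({p : P2 | v 0 ⬝ᵥ p.rep = 0} ∩ fiberOverFst E (.mk ℂ (u 0 ⨯₃ u 1) hu)) := by
  ext ⟨a, b⟩
  simp only [slice, Set.mem_ofPred_eq, Set.mem_prod, Set.mem_singleton_iff, Set.mem_inter_iff,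
    mem_fiberOverFst_iff, Fin.forall_fin_two, Fin.forall_fin_one, ← mk_cross_eq_iff hu]
  constructor
  · rintro ⟨hE, rfl, hv⟩
    exact ⟨rfl, hv, hE⟩
  · rintro ⟨rfl, hv, hE⟩
    exact ⟨hE, rfl, hv⟩

theorem encard_slice_biZeroLocus_standardEquation {u : Fin 2 → Fin 3 → ℂ} {v : Fin 1 → Fin 3 → ℂ}
    (huv : sliceDiscriminant (u 0) (u 1) (v 0) ≠ 0) :
    (slice (biZeroLocus standardEquation) u v).encard = 2 := by
  have hu : u 0 ⨯₃ u 1 ≠ 0 := fun h => huv (by simp [sliceDiscriminant, h, fiberMatrix_zero])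
  rw [slice_eq_singleton_prod hu, fiberOverFst_biZeroLocus_standardEquation, Set.singleton_prod,
    (Prod.mk_right_injective _).encard_image]
  exact encard_line_inter_quadric (isSymm_fiberMatrix _) huv

theorem hasMultidegree_biZeroLocus_standardEquation :
    HasMultidegree (biZeroLocus standardEquation) 2 1 2 := by
  let u (k : Fin 2) (i : Fin 3) : MvPolynomial ((Fin 2 × Fin 3) ⊕ (Fin 1 × Fin 3)) ℂ :=
    X (.inl (k, i))
  let v (i : Fin 3) : MvPolynomial ((Fin 2 × Fin 3) ⊕ (Fin 1 × Fin 3)) ℂ := X (.inr (0, i))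
  have eval_sliceDiscriminant (a : Fin 2 → Fin 3 → ℂ) (b : Fin 1 → Fin 3 → ℂ) :
      eval (Sum.elim (fun t => a t.1 t.2) fun t => b t.1 t.2)
        (sliceDiscriminant (u 0) (u 1) v) = sliceDiscriminant (a 0) (a 1) (b 0) := by
    rw [map_sliceDiscriminant]
    congr 1 <;> ext i <;> simp [u, v]
  refine ⟨sliceDiscriminant (u 0) (u 1) v, fun h => ?_, fun a b hab => ?_⟩
  · have heval := eval_sliceDiscriminant ![![0, 0, 1], ![1, -1, 0]] ![![1, 0, 0]]
    rw [h, map_zero] at heval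
    have hcross : ![0, 0, 1] ⨯₃ ![1, -1, 0] = (![1, 1, 0] : Fin 3 → ℂ) := by simp [cross_apply]
    simp only [sliceDiscriminant, cons_val, hcross, vec3_dotProduct, mulVec] at heval
    simp [fiberMatrix, adjugate_fin_three_of] at heval
  · exact encard_slice_biZeroLocus_standardEquation (eval_sliceDiscriminant a b ▸ hab)

end SliceDiscriminant

section Swap

variable {n : ℕ} (x y : Fin n → P2)

theorem fiberOverSnd_cameraCenters (b : P2) :
    fiberOverSnd (cameraCenters x y) b = fiberOverFst (cameraCenters y x) b := by
  rw [cameraCenters_swap x y, fiberOverFst_preimage_swap]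

theorem image_snd_cameraCenters :
    Prod.snd '' cameraCenters x y = Prod.fst '' cameraCenters y x := by
  rw [cameraCenters_swap x y, ← Set.image_swap_eq_preimage_swap, Set.image_image]
  rfl

end Swap

section GeneralPosition

variable {x y : Fin 4 → P2}

theorem exists_cameraCenters_eq_preimage_smul (hx : GeneralPosition x) (hy : GeneralPosition y) :
    ∃ g h : SL(3, ℂ), StandardPosition (g • x) ∧
      cameraCenters x y = Prod.map (g • ·) (h • ·) ⁻¹' biZeroLocus standardEquation := by
  obtain ⟨g, hgx⟩ := hx.exists_smul_standardPosition
  obtain ⟨h, hhy⟩ := hy.exists_smul_standardPosition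
  exact ⟨g, h, hgx, by rw [← cameraCenters_eq_biZeroLocus hgx hhy, preimage_cameraCenters_smul]⟩

theorem isHypersurfaceOfBidegree_cameraCenters (hx : GeneralPosition x) (hy : GeneralPosition y) :
    IsHypersurfaceOfBidegree (cameraCenters x y) 2 2 := by
  obtain ⟨g, h, -, hE⟩ := exists_cameraCenters_eq_preimage_smul hx hy
  rw [hE]
  exact IsHypersurfaceOfBidegree.preimage_smul ⟨standardEquation, prime_standardEquation.ne_zero,
    isBihomogeneous_standardEquation, isEquationOf_standardEquation⟩ g h

theorem image_fst_cameraCenters (hx : GeneralPosition x) (hy : GeneralPosition y) :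
    Prod.fst '' cameraCenters x y = Set.univ := by
  obtain ⟨g, h, -, hE⟩ := exists_cameraCenters_eq_preimage_smul hx hy
  refine Set.eq_univ_of_forall fun a => ⟨(a, h⁻¹ • g • a), ?_, rfl⟩
  rw [hE, Set.mem_preimage, Prod.map_apply, smul_inv_smul]
  exact diag_mem_biZeroLocus_standardEquation (g • a)

theorem hasMultidegree_cameraCenters (hx : GeneralPosition x) (hy : GeneralPosition y) :
    HasMultidegree (cameraCenters x y) 2 1 2 := by
  obtain ⟨g, h, -, hE⟩ := exists_cameraCenters_eq_preimage_smul hx hy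
  rw [hE]
  exact hasMultidegree_biZeroLocus_standardEquation.preimage_smul g h

theorem isConic_fiberOverFst_cameraCenters (hx : GeneralPosition x) (hy : GeneralPosition y)
    {a : P2} (ha : ∀ i, a ≠ x i) : IsConic (fiberOverFst (cameraCenters x y) a) := by
  obtain ⟨g, h, hgx, hE⟩ := exists_cameraCenters_eq_preimage_smul hx hy
  rw [hE, fiberOverFst_preimage_smul]
  exact (hgx.isConic_fiberOverFst fun i => (MulAction.injective g).ne (ha i)).preimage_smul h

theorem isNondegenerateConic_fiberOverFst_cameraCenters (hx : GeneralPosition x)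
    (hy : GeneralPosition y) {a : P2} (ha : OffLines x a) :
    IsNondegenerateConic (fiberOverFst (cameraCenters x y) a) := by
  obtain ⟨g, h, hgx, hE⟩ := exists_cameraCenters_eq_preimage_smul hx hy
  rw [hE, fiberOverFst_preimage_smul]
  exact (hgx.isNondegenerateConic_fiberOverFst (ha.smul g)).preimage_smul h

end GeneralPosition

end CameraCenters

theorem mainTheorem8 (x y : Fin 4 → CameraCenters.P2)
    (hx : CameraCenters.GeneralPosition x) (hy : CameraCenters.GeneralPosition y) :
    CameraCenters.IsHypersurface (CameraCenters.cameraCenters x y) ∧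
    (CameraCenters.StandardPosition x → CameraCenters.StandardPosition y →
      CameraCenters.IsEquationOf CameraCenters.standardEquation
        (CameraCenters.cameraCenters x y)) ∧
    (Prod.fst '' CameraCenters.cameraCenters x y = Set.univ ∧
      Prod.snd '' CameraCenters.cameraCenters x y = Set.univ) ∧
    (CameraCenters.IsHypersurfaceOfBidegree (CameraCenters.cameraCenters x y) 2 2 ∧
      CameraCenters.HasMultidegree (CameraCenters.cameraCenters x y) 2 1 2 ∧
      CameraCenters.HasMultidegree (CameraCenters.cameraCenters x y) 1 2 2) ∧
    ((∀ a, (∀ i, a ≠ x i) →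
        CameraCenters.IsConic
          (CameraCenters.fiberOverFst (CameraCenters.cameraCenters x y) a)) ∧
      (∀ a, CameraCenters.OffLines x a →
        CameraCenters.IsNondegenerateConic
          (CameraCenters.fiberOverFst (CameraCenters.cameraCenters x y) a)) ∧
      (∀ b, (∀ i, b ≠ y i) →
        CameraCenters.IsConic
          (CameraCenters.fiberOverSnd (CameraCenters.cameraCenters x y) b)) ∧
      (∀ b, CameraCenters.OffLines y b →
        CameraCenters.IsNondegenerateConic
          (CameraCenters.fiberOverSnd (CameraCenters.cameraCenters x y) b))) := by
  have hE := CameraCenters.isHypersurfaceOfBidegree_cameraCenters hx hy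
  refine ⟨⟨2, 2, by simp, hE⟩, fun hxs hys => ?_, ⟨CameraCenters.image_fst_cameraCenters hx hy, ?_⟩,
    ⟨hE, CameraCenters.hasMultidegree_cameraCenters hx hy, ?_⟩,
    fun a => CameraCenters.isConic_fiberOverFst_cameraCenters hx hy,
    fun a => CameraCenters.isNondegenerateConic_fiberOverFst_cameraCenters hx hy,
    fun b hb => ?_, fun b hb => ?_⟩
  · rw [CameraCenters.cameraCenters_eq_biZeroLocus hxs hys]
    exact CameraCenters.isEquationOf_standardEquation
  · rw [CameraCenters.image_snd_cameraCenters]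
    exact CameraCenters.image_fst_cameraCenters hy hx
  · rw [CameraCenters.cameraCenters_swap y x]
    exact (CameraCenters.hasMultidegree_cameraCenters hy hx).preimage_swap
  · rw [CameraCenters.fiberOverSnd_cameraCenters]
    exact CameraCenters.isConic_fiberOverFst_cameraCenters hy hx hb
  · rw [CameraCenters.fiberOverSnd_cameraCenters]
    exact CameraCenters.isNondegenerateConic_fiberOverFst_cameraCenters hy hx hb
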